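/- Let $k\ge 1$ be an integer, $n=2k-1$, $m=2k+1$, and let $B$ be the node-edge incidence matrix of the complete bipartite graph $K_{n,m}$, i.e. the integer matrix with $n+m$ rows whose $nm$ columns are the vectors $e_i\times e'_j\in\mathbf R^n\times\mathbf R^m$ ($1\le i\le n$, $1\le j\le m$), where $e_i$, $e'_j$ are the unit vectors. Let $pos(B)$ be the cone of nonnegative combinations of the columns of $B$. A triangulation of $B$ is a (finite) polyhedral complex of cones with union $pos(B)$, each of whose members is generated by a linearly independent set of columns of $B$. Then: (a) There is a unique coarsest polyhedral complex of cones that has union $pos(B)$ and refines all triangulations of $B$; it is called the chamber complex $\Gamma(B)$. (b) Exactly one member of $\Gamma(B)$ of dimension $\dim pos(B)$ contains the point $(\frac1n,\dots,\frac1n)\times(\frac1m,\dots,\frac1m)$; it is called the central chamber. (c) For all $C_+\subseteq\{1,\dots,n\}$ and $D_+\subseteq\{1,\dots,m\}$ with $|C_+|=k$ and $|D_+|=k+1$, and with complements $C_-$ and $D_-$, the hyperplane $$\sum_{i\in C_+}u_i-\sum_{i\in C_-}u_i-\sum_{j\in D_+}v_j+\sum_{j\in D_-}v_j=0$$ (a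 cut hyperplane of type $(k,k+1)$) meets the central chamber in a facet, that is, in a face of codimension one in the chamber. There are exactly $\binom{2k-1}{k}\binom{2k+1}{k+1}$ distinct facets of this kind. (d) If $k\ge 2$, then $\binom{2k-1}{k}\binom{2k+1}{k+1}>4^k$; in particular the central chamber has at least $4^k$ facets. -/

import Mathlib

noncomputable section

namespace ChamberComplex

/-! ### Polyhedral cones and complexes of cones -/

section Cones

variable {V : Type*} [AddCommGroup V] [Module ℝ V]

/-- A polyhedral cone: an intersection of finitely many closed linear halfspaces. -/
def IsPolyhedralCone (C : PointedCone ℝ V) : Prop :=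
  C.DualFG (LinearMap.id : Module.Dual ℝ V →ₗ[ℝ] V →ₗ[ℝ] ℝ)

/-- The dimension of a cone: the dimension of its linear span. -/
def coneDim (C : PointedCone ℝ V) : ℕ :=
  Module.finrank ℝ (Submodule.span ℝ (C : Set V))

/-- A facet of a cone: a face of codimension one. -/
def IsFacet (F C : PointedCone ℝ V) : Prop :=
  F.IsFaceOf C ∧ coneDim F + 1 = coneDim C

/-- A polyhedral complex of cones: a finite collection of polyhedral cones which contains every
(nonempty) face of each of its members, and in which any two members meet in a common face. -/
structure IsPolyhedralComplex (Γ : Set (PointedCone ℝ V)) : Prop where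
  finite : Γ.Finite
  polyhedral : ∀ C ∈ Γ, IsPolyhedralCone C
  face_mem : ∀ C ∈ Γ, ∀ F : PointedCone ℝ V, F.IsFaceOf C → F ∈ Γ
  inter_left : ∀ C ∈ Γ, ∀ D ∈ Γ, (C ⊓ D).IsFaceOf C
  inter_right : ∀ C ∈ Γ, ∀ D ∈ Γ, (C ⊓ D).IsFaceOf D

/-- The complex `Γ` covers the cone `P`: the union of its members is `P`. -/
def Covers (Γ : Set (PointedCone ℝ V)) (P : PointedCone ℝ V) : Prop :=
  (⋃ C ∈ Γ, (C : Set V)) = (P : Set V)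

/-- `Γ` refines `Γ'`: every member of `Γ` lies in a member of `Γ'`. -/
def Refines (Γ Γ' : Set (PointedCone ℝ V)) : Prop :=
  ∀ C ∈ Γ, ∃ C' ∈ Γ', C ≤ C'

end Cones

/-! ### Triangulations and the chamber complex of an integer matrix -/

section Matrices

variable {κ ι : Type*}

/-- The `j`-th column of an integer matrix, as a real vector. -/
def column (B : Matrix κ ι ℤ) (j : ι) : κ → ℝ := fun i => (B i j : ℝ)

/-- The cone `pos(B)` of nonnegative combinations of the columns of `B`. -/
def pos (B : Matrix κ ι ℤ) : PointedCone ℝ (κ → ℝ) :=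
  PointedCone.hull ℝ (Set.range (column B))

/-- A triangulation of (the columns of) `B`: a polyhedral complex covering `pos(B)` whose members
are simplicial cones, each generated by a linearly independent set of columns of `B`. -/
structure IsTriangulation (B : Matrix κ ι ℤ) (T : Set (PointedCone ℝ (κ → ℝ))) : Prop where
  complex : IsPolyhedralComplex T
  covers : Covers T (pos B)
  simplicial : ∀ σ ∈ T, ∃ S : Set (κ → ℝ), S ⊆ Set.range (column B) ∧
    LinearIndepOn ℝ id S ∧ PointedCone.hull ℝ S = σ

/-- `Γ` is a polyhedral complex which covers `pos(B)` and refines all triangulations of `B`. -/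
structure IsCommonRefinement (B : Matrix κ ι ℤ) (Γ : Set (PointedCone ℝ (κ → ℝ))) : Prop where
  complex : IsPolyhedralComplex Γ
  covers : Covers Γ (pos B)
  refines : ∀ T, IsTriangulation B T → Refines Γ T

/-- `Γ` is the chamber complex of `B`: the coarsest polyhedral complex which covers `pos(B)` and
refines all triangulations of `B`. -/
def IsChamberComplex (B : Matrix κ ι ℤ) (Γ : Set (PointedCone ℝ (κ → ℝ))) : Prop :=
  IsCommonRefinement B Γ ∧ ∀ Γ', IsCommonRefinement B Γ' → Refines Γ' Γ

/-- The full-dimensional chambers of a complex `Γ` subdividing `pos(B)`: the members of `Γ` of the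
same dimension as `pos(B)`. -/
def IsFullChamber (B : Matrix κ ι ℤ) (Γ : Set (PointedCone ℝ (κ → ℝ)))
    (C : PointedCone ℝ (κ → ℝ)) : Prop :=
  C ∈ Γ ∧ coneDim C = coneDim (pos B)

end Matrices

/-! ### Complete bipartite graphs -/

section Bipartite

/-- The node-edge incidence matrix of the complete bipartite graph `K_{n,m}`: the column of the
edge `(i, j)` is `e_i × e'_j`. -/
def incidence (n m : ℕ) : Matrix (Fin n ⊕ Fin m) (Fin n × Fin m) ℤ :=
  fun x e => Sum.elim (fun i => if i = e.1 then 1 else 0) (fun j => if j = e.2 then 1 else 0) x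

/-- The point `(1/n, …, 1/n) × (1/m, …, 1/m)`. -/
def center (n m : ℕ) : Fin n ⊕ Fin m → ℝ :=
  Sum.elim (fun _ => 1 / (n : ℝ)) (fun _ => 1 / (m : ℝ))

/-- `C` is the central chamber of the complex `Γ`: the full-dimensional chamber which contains
`(1/n, …, 1/n) × (1/m, …, 1/m)`. -/
def IsCentralChamber (n m : ℕ) (Γ : Set (PointedCone ℝ (Fin n ⊕ Fin m → ℝ)))
    (C : PointedCone ℝ (Fin n ⊕ Fin m → ℝ)) : Prop :=
  IsFullChamber (incidence n m) Γ C ∧ center n m ∈ C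

/-- The linear form of the cut `(P, Pᶜ; Q, Qᶜ)` of `K_{n,m}`, which sends `u × v` to
`∑_{i ∈ P} u_i - ∑_{i ∉ P} u_i - ∑_{j ∈ Q} v_j + ∑_{j ∉ Q} v_j`. -/
def cutForm {n m : ℕ} (P : Finset (Fin n)) (Q : Finset (Fin m)) :
    (Fin n ⊕ Fin m → ℝ) →ₗ[ℝ] ℝ :=
  ∑ i ∈ P, LinearMap.proj (Sum.inl i) - ∑ i ∈ Pᶜ, LinearMap.proj (Sum.inl i)
    - ∑ j ∈ Q, LinearMap.proj (Sum.inr j) + ∑ j ∈ Qᶜ, LinearMap.proj (Sum.inr j)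

/-- The hyperplane of the cut `(P, Pᶜ; Q, Qᶜ)`; its type is `(card P, card Q)`. -/
def cutHyperplane {n m : ℕ} (P : Finset (Fin n)) (Q : Finset (Fin m)) :
    Submodule ℝ (Fin n ⊕ Fin m → ℝ) :=
  LinearMap.ker (cutForm P Q)

/-- The subcone which the hyperplane of the cut `(P, Pᶜ; Q, Qᶜ)` cuts out of the cone `C`. -/
def cutSection {n m : ℕ} (C : PointedCone ℝ (Fin n ⊕ Fin m → ℝ))
    (P : Finset (Fin n)) (Q : Finset (Fin m)) : PointedCone ℝ (Fin n ⊕ Fin m → ℝ) :=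
  C ⊓ PointedCone.ofSubmodule (cutHyperplane P Q)

end Bipartite

end ChamberComplex

end

/-! Only finitely many triangulations exist, so the intersections of one member of each form a
complex, and every complex refining all triangulations refines it: this is the chamber complex
(`chamberComplex_isChamberComplex`). It covers `pos(B)` once some triangulation exists; staircases
supply one, since each point of `pos(B)` has a unique noncrossing flow.

Chambers of generic points are governed by cuts. Dropping a generator from a full-dimensional
simplicial cone on edges leaves a disconnected graph, so its facets lie in cut hyperplanes. Hence
every simplicial cone containing a generic c contains all of `cutRegion c`
(`cutRegion_subset_hull`). Conversely, the staircase triangulation that lists P and Q first keeps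
each chamber on one side of the cut (P, Q) (`cutValue_nonneg_of_mem_chamberComplex`).

The center is generic because n and m are coprime, so its chamber is unique and full-dimensional.
For a cut of type (k, k + 1), `facetPoint` lies in the cut region of the center and on no other
proper cut hyperplane. Thus the hyperplane meets the chamber in codimension one, and distinct cuts
give distinct facets. -/

noncomputable section

namespace ChamberComplex

/-! ### Common refinements of complexes and existence of the chamber complex -/

section General

variable {V : Type*} [AddCommGroup V] [Module ℝ V]

/-- The smallest face of the cone `C` containing `x`, provided that `x` lies in `C`. -/
def minFace (C : PointedCone ℝ V) (x : V) : PointedCone ℝ V where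
  carrier := {y | y ∈ C ∧ ∃ t : ℝ, 0 ≤ t ∧ t • x - y ∈ C}
  zero_mem' := ⟨C.zero_mem, 0, le_rfl, by simp⟩
  add_mem' := by
    rintro y z ⟨hy, s, hs, hsy⟩ ⟨hz, t, ht, htz⟩
    refine ⟨C.add_mem hy hz, s + t, add_nonneg hs ht, ?_⟩
    have : (s + t) • x - (y + z) = (s • x - y) + (t • x - z) := by module
    rw [this]
    exact C.add_mem hsy htz
  smul_mem' := by
    rintro ⟨a, ha⟩ y ⟨hy, s, hs, hsy⟩
    refine ⟨PointedCone.smul_mem C ha hy, a * s, mul_nonneg ha hs, ?_⟩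
    have : (a * s) • x - a • y = a • (s • x - y) := by module
    change (a * s) • x - a • y ∈ C
    rw [this]
    exact PointedCone.smul_mem C ha hsy

theorem minFace_isFaceOf (C : PointedCone ℝ V) (x : V) : (minFace C x).IsFaceOf C := by
  refine PointedCone.IsFaceOf.of_mem_of_add_mem_left (fun y hy => hy.1) ?_
  rintro y z hy hz ⟨-, t, ht, h⟩
  refine ⟨hy, t, ht, ?_⟩
  have : t • x - y = (t • x - (y + z)) + z := by module
  rw [this]
  exact C.add_mem h hz

/-- A cone in a finite-dimensional space has a point in its relative interior. -/
theorem exists_mem_forall_smul_sub_mem [FiniteDimensional ℝ V] (C : PointedCone ℝ V) :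
    ∃ x ∈ C, ∀ y ∈ C, ∃ t : ℝ, 0 ≤ t ∧ t • x - y ∈ C := by
  obtain ⟨b, hbC, hspan, hli⟩ := exists_linearIndependent ℝ (C : Set V)
  have hfin : b.Finite := hli.setFinite
  lift b to Finset V using hfin
  -- The point is the sum of a basis of the span chosen inside `C`; the multiple `∑ |c v|` exceeds
  -- every coordinate of `y`.
  refine ⟨∑ v ∈ b, v, C.sum_mem fun v hv => hbC hv, fun y hy => ?_⟩
  have hy' : y ∈ Submodule.span ℝ (b : Set V) := by
    rw [hspan]
    exact Submodule.subset_span hy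
  obtain ⟨c, -, rfl⟩ := Submodule.mem_span_finset.1 hy'
  refine ⟨∑ v ∈ b, |c v|, Finset.sum_nonneg fun _ _ => abs_nonneg _, ?_⟩
  rw [Finset.smul_sum, ← Finset.sum_sub_distrib]
  refine C.sum_mem fun v hv => ?_
  rw [← sub_smul]
  refine PointedCone.smul_mem C ?_ (hbC hv)
  have h1 : |c v| ≤ ∑ w ∈ b, |c w| :=
    Finset.single_le_sum (f := fun w => |c w|) (fun _ _ => abs_nonneg _) hv
  linarith [le_abs_self (c v)]

/-- The intersections of one member of each complex of a family. -/
def commonRefinement {ι : Type*} (T : ι → Set (PointedCone ℝ V)) : Set (PointedCone ℝ V) :=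
  {C | ∃ f : ι → PointedCone ℝ V, (∀ i, f i ∈ T i) ∧ ⨅ i, f i = C}

theorem iInf_isFaceOf {ι : Type*} {f g : ι → PointedCone ℝ V} (h : ∀ i, (f i).IsFaceOf (g i)) :
    (⨅ i, f i).IsFaceOf (⨅ i, g i) := by
  refine PointedCone.IsFaceOf.of_mem_of_add_mem_left (iInf_mono fun i => (h i).le) ?_
  intro x y hx hy hxy
  rw [Submodule.mem_iInf] at *
  exact fun i => (h i).mem_of_add_mem_left (hx i) (hy i) (hxy i)

theorem isPolyhedralCone_iInf {ι : Type*} [Finite ι] {f : ι → PointedCone ℝ V}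
    (h : ∀ i, IsPolyhedralCone (f i)) : IsPolyhedralCone (⨅ i, f i) := by
  choose s hs using h
  have := PointedCone.DualFG.dual_of_finite (LinearMap.id : Module.Dual ℝ V →ₗ[ℝ] V →ₗ[ℝ] ℝ)
    (Set.finite_iUnion fun i => (s i).finite_toSet)
  rwa [PointedCone.dual_iUnion, iInf_congr hs] at this

/-- The delicate point is closure under faces: a face `F` of an intersection is the intersection of
the minimal faces, in the individual cones, of a relative interior point of `F`. -/
theorem commonRefinement_isPolyhedralComplex [FiniteDimensional ℝ V] {ι : Type*} [Finite ι]
    {T : ι → Set (PointedCone ℝ V)} (hT : ∀ i, IsPolyhedralComplex (T i)) :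
    IsPolyhedralComplex (commonRefinement T) := by
  have hinter : ∀ C ∈ commonRefinement T, ∀ D ∈ commonRefinement T, (C ⊓ D).IsFaceOf C := by
    rintro _ ⟨f, hf, rfl⟩ _ ⟨g, hg, rfl⟩
    rw [← iInf_inf_eq]
    exact iInf_isFaceOf fun i => (hT i).inter_left _ (hf i) _ (hg i)
  refine ⟨?_, ?_, ?_, hinter, fun C hC D hD => inf_comm C D ▸ hinter D hD C hC⟩
  · have := (Set.Finite.pi' fun i => (hT i).finite).image (fun f => ⨅ i, f i)
    exact this.subset fun C ⟨f, hf, h⟩ => ⟨f, hf, h⟩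
  · rintro _ ⟨f, hf, rfl⟩
    exact isPolyhedralCone_iInf fun i => (hT i).polyhedral _ (hf i)
  · rintro _ ⟨f, hf, rfl⟩ F hF
    obtain ⟨x, hx, hxF⟩ := exists_mem_forall_smul_sub_mem F
    refine ⟨fun i => minFace (f i) x,
      fun i => (hT i).face_mem _ (hf i) _ (minFace_isFaceOf _ _), le_antisymm ?_ ?_⟩
    · intro y hy
      rw [Submodule.mem_iInf] at hy
      choose hy t ht hty using hy
      have hx' := Submodule.mem_iInf _ |>.1 (hF.le hx)
      cases nonempty_fintype ι
      -- Each cone comes with its own multiple `t i`; their sum serves all cones at once, which is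
      -- where finiteness of the family enters.
      have hs : 0 ≤ ∑ i, t i := Finset.sum_nonneg fun i _ => ht i
      refine hF.mem_of_add_mem_left (y := (∑ i, t i) • x - y) (Submodule.mem_iInf _ |>.2 hy)
        (Submodule.mem_iInf _ |>.2 fun i => ?_) ?_
      · have : (∑ i, t i) • x - y = (∑ i, t i - t i) • x + (t i • x - y) := by module
        rw [this]
        refine (f i).add_mem (PointedCone.smul_mem _ ?_ (hx' i)) (hty i)
        exact sub_nonneg.2 (Finset.single_le_sum (fun i _ => ht i) (Finset.mem_univ i))
      · rw [add_sub_cancel]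
        exact PointedCone.smul_mem _ hs hx
    · intro y hy
      obtain ⟨t, ht, hty⟩ := hxF y hy
      have h1 := Submodule.mem_iInf _ |>.1 (hF.le hy)
      have h2 := Submodule.mem_iInf _ |>.1 (hF.le hty)
      exact Submodule.mem_iInf _ |>.2 fun i => ⟨h1 i, t, ht, h2 i⟩

theorem commonRefinement_covers {ι : Type*} [Nonempty ι] {T : ι → Set (PointedCone ℝ V)}
    {P : PointedCone ℝ V} (hT : ∀ i, Covers (T i) P) : Covers (commonRefinement T) P := by
  ext x
  simp only [Set.mem_iUnion, exists_prop]
  constructor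
  · rintro ⟨_, ⟨f, hf, rfl⟩, hx⟩
    obtain ⟨i⟩ := ‹Nonempty ι›
    rw [← hT i]
    exact Set.mem_biUnion (hf i) (Submodule.mem_iInf _ |>.1 hx i)
  · intro hx
    have h : ∀ i, ∃ C ∈ T i, x ∈ C := fun i => by
      rw [← hT i] at hx
      simpa using hx
    choose f hf hxf using h
    exact ⟨_, ⟨f, hf, rfl⟩, Submodule.mem_iInf _ |>.2 hxf⟩

/-- In a chain C ≤ C' ≤ C'' with outer terms in `Γ`, C is a face of C'', hence of C', hence a member
of `Γ'`. -/
theorem IsPolyhedralComplex.subset_of_refines {Γ Γ' : Set (PointedCone ℝ V)}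
    (h : IsPolyhedralComplex Γ) (h' : IsPolyhedralComplex Γ')
    (h₁ : Refines Γ Γ') (h₂ : Refines Γ' Γ) : Γ ⊆ Γ' := by
  intro C hC
  obtain ⟨C', hC', hle⟩ := h₁ C hC
  obtain ⟨C'', hC'', hle'⟩ := h₂ C' hC'
  have hface : C.IsFaceOf C'' := by
    simpa [inf_eq_left.2 (hle.trans hle')] using h.inter_right C hC C'' hC''
  exact h'.face_mem C' hC' C ⟨hle, fun hx hy ha hxy =>
    hface.mem_of_smul_add_mem (hle' hx) (hle' hy) ha hxy⟩

variable {κ ι : Type*}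

theorem IsChamberComplex.eq {B : Matrix κ ι ℤ} {Γ Γ' : Set (PointedCone ℝ (κ → ℝ))}
    (h : IsChamberComplex B Γ) (h' : IsChamberComplex B Γ') : Γ = Γ' :=
  (h.1.complex.subset_of_refines h'.1.complex (h'.2 _ h.1) (h.2 _ h'.1)).antisymm
    (h'.1.complex.subset_of_refines h.1.complex (h.2 _ h'.1) (h'.2 _ h.1))

theorem finite_setOf_isTriangulation [Finite ι] (B : Matrix κ ι ℤ) :
    {T | IsTriangulation B T}.Finite := by
  have h : ((PointedCone.hull ℝ) '' (Set.range (column B)).powerset).Finite :=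
    (Set.finite_range (column B)).powerset.image _
  refine h.finite_subsets.subset fun T hT σ hσ => ?_
  obtain ⟨S, hS, -, rfl⟩ := hT.simplicial σ hσ
  exact ⟨S, hS, rfl⟩

/-- The chamber complex: all intersections of one member of each triangulation. -/
def chamberComplex (B : Matrix κ ι ℤ) : Set (PointedCone ℝ (κ → ℝ)) :=
  commonRefinement fun T : {T // IsTriangulation B T} => T.1

theorem chamberComplex_isChamberComplex [Finite κ] [Finite ι] {B : Matrix κ ι ℤ}
    (hB : ∃ T, IsTriangulation B T) : IsChamberComplex B (chamberComplex B) := by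
  have : Finite {T // IsTriangulation B T} := (finite_setOf_isTriangulation B).to_subtype
  have : Nonempty {T // IsTriangulation B T} := let ⟨T, hT⟩ := hB; ⟨⟨T, hT⟩⟩
  refine ⟨⟨commonRefinement_isPolyhedralComplex fun T => T.2.complex,
    commonRefinement_covers fun T => T.2.covers, ?_⟩, fun Γ' h => ?_⟩
  · rintro T hT _ ⟨f, hf, rfl⟩
    exact ⟨_, hf ⟨T, hT⟩, iInf_le _ _⟩
  · intro C hC
    choose f hf hle using fun T : {T // IsTriangulation B T} => h.refines T.1 T.2 C hC
    exact ⟨_, ⟨f, hf, rfl⟩, le_iInf hle⟩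

end General

/-! ### Cones generated by finite families and by independent sets -/

section Hull

variable {V : Type*} [AddCommGroup V] [Module ℝ V]

/-- Coefficients are functions on the whole index type with a support condition, so that
representations over different sets `E` can be compared. -/
theorem mem_hull_image_iff {ι : Type*} [Fintype ι] {v : ι → V} {E : Set ι} {x : V} :
    x ∈ PointedCone.hull ℝ (v '' E) ↔
      ∃ f : ι → ℝ, (∀ e, 0 ≤ f e) ∧ (∀ e, f e ≠ 0 → e ∈ E) ∧ ∑ e, f e • v e = x := by
  classical
  constructor
  · intro hx
    induction hx using Submodule.span_induction with
    | mem x hx =>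
      obtain ⟨e, he, rfl⟩ := hx
      refine ⟨Pi.single e 1, fun e' => ?_, fun e' he' => ?_, ?_⟩
      · by_cases h : e' = e
        · subst h; simp
        · simp [h]
      · by_contra h
        exact he' (Pi.single_eq_of_ne (fun h' => h (by rwa [h'])) _)
      · simp [Pi.single_apply, ite_smul]
    | zero => exact ⟨0, by simp, by simp, by simp⟩
    | add x y _ _ hx hy =>
      obtain ⟨f, hf, hfE, rfl⟩ := hx
      obtain ⟨g, hg, hgE, rfl⟩ := hy
      refine ⟨f + g, fun e => add_nonneg (hf e) (hg e), fun e he => ?_, ?_⟩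
      · by_contra h
        exact he (by simp [not_not.1 (mt (hfE e) h), not_not.1 (mt (hgE e) h)])
      · simp [add_smul, Finset.sum_add_distrib]
    | smul a x _ hx =>
      obtain ⟨f, hf, hfE, rfl⟩ := hx
      refine ⟨fun e => a * f e, fun e => mul_nonneg a.2 (hf e),
        fun e he => hfE e (right_ne_zero_of_mul he), ?_⟩
      rw [Finset.smul_sum]
      exact Finset.sum_congr rfl fun e _ => mul_smul _ _ _
  · rintro ⟨f, hf, hfE, rfl⟩
    refine Submodule.sum_mem _ fun e _ => ?_
    by_cases he : f e = 0
    · simp [he]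
    · exact PointedCone.smul_mem _ (hf e) (PointedCone.subset_hull (Set.mem_image_of_mem v (hfE e he)))

theorem eq_hull_of_isFaceOf_hull_image {ι : Type*} [Fintype ι] {v : ι → V} {E : Set ι}
    {F : PointedCone ℝ V} (hF : F.IsFaceOf (PointedCone.hull ℝ (v '' E))) :
    F = PointedCone.hull ℝ (v '' {e ∈ E | v e ∈ F}) := by
  classical
  apply le_antisymm
  · intro x hx
    obtain ⟨f, hf, hfE, rfl⟩ := mem_hull_image_iff.1 (hF.le hx)
    refine mem_hull_image_iff.2 ⟨f, hf, fun e he => ⟨hfE e he, ?_⟩, rfl⟩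
    rw [← Finset.add_sum_erase _ _ (Finset.mem_univ e)] at hx
    refine hF.mem_of_smul_add_mem
      (PointedCone.subset_hull (Set.mem_image_of_mem v (hfE e he))) ?_
      ((hf e).lt_of_ne' he) hx
    refine Submodule.sum_mem _ fun e' _ => ?_
    by_cases he' : f e' = 0
    · simp [he']
    · exact PointedCone.smul_mem _ (hf e')
        (PointedCone.subset_hull (Set.mem_image_of_mem v (hfE e' he')))
  · refine Submodule.span_le.2 ?_
    rintro _ ⟨e, he, rfl⟩
    exact he.2

/-- After extending `S` to a basis, the cone is cut out by nonnegativity of all coordinates and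
nonpositivity of those outside `S`. -/
theorem isPolyhedralCone_hull [FiniteDimensional ℝ V] {S : Set V} (hS : LinearIndepOn ℝ id S) :
    IsPolyhedralCone (PointedCone.hull ℝ S) := by
  classical
  let b := Module.Basis.extend hS
  have hSb : S ⊆ hS.extend (Set.subset_univ S) := hS.subset_extend _
  have hfin : Finite (hS.extend (Set.subset_univ S)) := Module.Finite.finite_basis b
  have := PointedCone.DualFG.dual_of_finite (LinearMap.id : Module.Dual ℝ V →ₗ[ℝ] V →ₗ[ℝ] ℝ)
    ((Set.finite_range fun i => b.coord i).union
      ((Set.finite_range fun i : {i : hS.extend (Set.subset_univ S) // (i : V) ∉ S} =>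
        - b.coord i)))
  unfold IsPolyhedralCone
  convert this using 1
  have hb : ∀ i, b i = i := fun i => Module.Basis.extend_apply_self hS i
  ext x
  rw [PointedCone.mem_dual]
  constructor
  · intro hx
    induction hx using Submodule.span_induction with
    | mem x hx =>
      rintro _ (⟨i, rfl⟩ | ⟨i, rfl⟩)
      · have : x = b ⟨x, hSb hx⟩ := (hb ⟨x, hSb hx⟩).symm
        rw [this]
        simp only [LinearMap.id_apply, Module.Basis.coord_apply, Module.Basis.repr_self,
          Finsupp.single_apply]
        split_ifs <;> simp
      · have : x = b ⟨x, hSb hx⟩ := (hb ⟨x, hSb hx⟩).symm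
        rw [this]
        have hne : (⟨x, hSb hx⟩ : hS.extend (Set.subset_univ S)) ≠ i.1 := by
          intro h
          exact i.2 (by rw [← h]; exact hx)
        simp [hne]
    | zero => intro φ _; simp
    | add x y _ _ hx hy =>
      intro φ hφ
      simpa using add_nonneg (hx hφ) (hy hφ)
    | smul a x _ hx =>
      intro φ hφ
      have h1 : (LinearMap.id : Module.Dual ℝ V →ₗ[ℝ] V →ₗ[ℝ] ℝ) φ (a • x)
        = (a : ℝ) * φ x := map_smul φ (a : ℝ) x
      rw [h1]
      exact mul_nonneg a.2 (hx hφ)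
  · intro h
    cases nonempty_fintype (hS.extend (Set.subset_univ S))
    rw [← b.sum_repr x]
    refine Submodule.sum_mem _ fun i _ => ?_
    have h1 : 0 ≤ b.repr x i := h (Or.inl ⟨i, rfl⟩)
    by_cases hi : (i : V) ∈ S
    · rw [hb]
      exact PointedCone.smul_mem _ h1 (PointedCone.subset_hull hi)
    · have h2 : 0 ≤ - b.repr x i := h (Or.inr ⟨⟨i, hi⟩, rfl⟩)
      have h3 : b.repr x i = 0 := by linarith
      rw [h3, zero_smul]
      exact Submodule.zero_mem _

end Hull

/-! ### Staircase triangulations of the complete bipartite graph -/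

section Staircase

variable {n m : ℕ}

/-- The column of the edge `e`. -/
abbrev edgeVector (e : Fin n × Fin m) : Fin n ⊕ Fin m → ℝ := column (incidence n m) e

theorem sum_smul_edgeVector_inl (f : Fin n × Fin m → ℝ) (i : Fin n) :
    (∑ e, f e • edgeVector e) (Sum.inl i) = ∑ j, f (i, j) := by
  simp only [Finset.sum_apply, Pi.smul_apply, column, incidence, Sum.elim_inl, smul_eq_mul,
    Fintype.sum_prod_type]
  rw [Finset.sum_eq_single i] <;> simp +contextual [eq_comm]

theorem sum_smul_edgeVector_inr (f : Fin n × Fin m → ℝ) (j : Fin m) :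
    (∑ e, f e • edgeVector e) (Sum.inr j) = ∑ i, f (i, j) := by
  simp only [Finset.sum_apply, Pi.smul_apply, column, incidence, Sum.elim_inr, smul_eq_mul,
    Fintype.sum_prod_type]
  refine Finset.sum_congr rfl fun i _ => ?_
  simp

/-- A set of edges is a staircase with respect to the orders given by the ranks `p` and `q` if no
two of its edges cross. -/
def IsStaircase (p : Fin n → ℕ) (q : Fin m → ℕ) (E : Set (Fin n × Fin m)) : Prop :=
  ∀ e ∈ E, ∀ e' ∈ E, p e.1 < p e'.1 → q e.2 ≤ q e'.2

theorem exists_mul_neg_of_sum_eq_zero {ι : Type*} [Fintype ι] {c : ι → ℝ} (hc : ∑ i, c i = 0)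
    {i : ι} (hi : c i ≠ 0) : ∃ i', c i * c i' < 0 := by
  by_contra! h
  have : 0 < ∑ i', c i * c i' :=
    Finset.sum_pos' (fun i' _ => h i') ⟨i, Finset.mem_univ i, mul_self_pos.2 hi⟩
  rw [← Finset.mul_sum, hc, mul_zero] at this
  exact this.false

/-- Take the last nonzero row and its last nonzero entry (a, b). Row and column sums vanish, so
entries of the opposite sign occur earlier in that row and column; the edges (a', b) and (a, b')
cross. -/
theorem exists_corner {p : Fin n → ℕ} {q : Fin m → ℕ} (hp : p.Injective) (hq : q.Injective)
    {h : Fin n × Fin m → ℝ} (hsum : ∑ e, h e • edgeVector e = 0) (hne : h ≠ 0) :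
    ∃ a a' b b', p a' < p a ∧ q b' < q b ∧ h (a, b) * h (a, b') < 0 ∧
      h (a, b) * h (a', b) < 0 := by
  classical
  obtain ⟨⟨i, j⟩, hij⟩ := Function.ne_iff.1 hne
  obtain ⟨a, ha, hamax⟩ := Finset.exists_max_image {i | ∃ j, h (i, j) ≠ 0} p
    ⟨i, by simpa using ⟨j, hij⟩⟩
  simp only [Finset.mem_filter, Finset.mem_univ, true_and] at ha hamax
  obtain ⟨j, haj⟩ := ha
  obtain ⟨b, hb, hbmax⟩ := Finset.exists_max_image {j | h (a, j) ≠ 0} q ⟨j, by simpa using haj⟩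
  simp only [Finset.mem_filter, Finset.mem_univ, true_and] at hb hbmax
  obtain ⟨b', hb'⟩ := exists_mul_neg_of_sum_eq_zero (c := fun j => h (a, j))
    (by rw [← sum_smul_edgeVector_inl, hsum]; rfl) hb
  obtain ⟨a', ha'⟩ := exists_mul_neg_of_sum_eq_zero (c := fun i => h (i, b))
    (by rw [← sum_smul_edgeVector_inr, hsum]; rfl) hb
  refine ⟨a, a', b, b', ?_, ?_, hb', ha'⟩
  · refine (hamax a' ⟨b, right_ne_zero_of_mul ha'.ne⟩).lt_of_ne fun h' => ?_
    rw [hp h'] at ha'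
    exact absurd ha' (mul_self_nonneg _).not_gt
  · refine (hbmax b' (right_ne_zero_of_mul hb'.ne)).lt_of_ne fun h' => ?_
    rw [hq h'] at hb'
    exact absurd hb' (mul_self_nonneg _).not_gt

theorem IsStaircase.linearIndepOn {p : Fin n → ℕ} {q : Fin m → ℕ} (hp : p.Injective)
    (hq : q.Injective) {E : Set (Fin n × Fin m)} (hE : IsStaircase p q E) :
    LinearIndepOn ℝ edgeVector E := by
  classical
  rw [linearIndepOn_iff']
  intro s g hs hsum
  let h : Fin n × Fin m → ℝ := fun e => if e ∈ s then g e else 0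
  have hsupp : ∀ e, h e ≠ 0 → e ∈ E := fun e he => hs (by_contra fun h' => he (if_neg h'))
  have hsum' : ∑ e, h e • edgeVector e = 0 := by
    rw [← hsum]
    simp [h, ite_smul]
  by_contra! hne
  obtain ⟨e, hes, he⟩ := hne
  have hh : h ≠ 0 := fun h0 => he (by simpa [h, hes] using congrFun h0 e)
  obtain ⟨a, a', b, b', hp', hq', h1, h2⟩ := exists_corner hp hq hsum' hh
  have := hE _ (hsupp _ (right_ne_zero_of_mul h2.ne)) _ (hsupp _ (right_ne_zero_of_mul h1.ne)) hp'
  exact absurd this hq'.not_ge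

/-- In the difference of two flows, the two crossing edges given by `exists_corner` carry the same
sign, so both lie in the support of the same flow, which is a staircase. -/
theorem IsStaircase.flow_unique {p : Fin n → ℕ} {q : Fin m → ℕ} (hp : p.Injective)
    (hq : q.Injective) {E E' : Set (Fin n × Fin m)} (hE : IsStaircase p q E)
    (hE' : IsStaircase p q E') {f g : Fin n × Fin m → ℝ} (hf : ∀ e, 0 ≤ f e) (hg : ∀ e, 0 ≤ g e)
    (hfE : ∀ e, f e ≠ 0 → e ∈ E) (hgE : ∀ e, g e ≠ 0 → e ∈ E')
    (hfg : ∑ e, f e • edgeVector e = ∑ e, g e • edgeVector e) : f = g := by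
  by_contra hne
  have hsum : ∑ e, (f - g) e • edgeVector e = 0 := by
    simp [sub_smul, Finset.sum_sub_distrib, hfg]
  obtain ⟨a, a', b, b', hp', hq', h1, h2⟩ := exists_corner hp hq hsum (sub_ne_zero.2 hne)
  simp only [Pi.sub_apply] at h1 h2
  rcases lt_trichotomy (f (a, b) - g (a, b)) 0 with h | h | h
  · have h1' := pos_of_mul_neg_right h1 h.le
    have h2' := pos_of_mul_neg_right h2 h.le
    have := hE (a', b) (hfE _ (by linarith [hg (a', b)] : 0 < f (a', b)).ne') (a, b')
      (hfE _ (by linarith [hg (a, b')] : 0 < f (a, b')).ne') hp'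
    exact absurd this hq'.not_ge
  · simp [h] at h1
  · have h1' := neg_of_mul_neg_right h1 h.le
    have h2' := neg_of_mul_neg_right h2 h.le
    have := hE' (a', b) (hgE _ (by linarith [hf (a', b)] : 0 < g (a', b)).ne') (a, b')
      (hgE _ (by linarith [hf (a, b')] : 0 < g (a, b')).ne') hp'
    exact absurd this hq'.not_ge

/-- The north-west corner rule. -/
theorem exists_staircase_flow (p : Fin n → ℕ) (q : Fin m → ℕ) (x : Fin n ⊕ Fin m → ℝ)
    (hx : ∀ z, 0 ≤ x z) (hbal : ∑ i, x (Sum.inl i) = ∑ j, x (Sum.inr j)) :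
    ∃ f : Fin n × Fin m → ℝ, (∀ e, 0 ≤ f e) ∧ IsStaircase p q {e | f e ≠ 0} ∧
      ∑ e, f e • edgeVector e = x := by
  classical
  induction hN : Finset.card {z | x z ≠ 0} using Nat.strong_induction_on generalizing x with
  | _ N ih =>
  by_cases h0 : ∀ i, x (Sum.inl i) = 0
  · refine ⟨0, by simp, by simp [IsStaircase], ?_⟩
    have h1 : ∀ j, x (Sum.inr j) = 0 := by
      have : ∑ j, x (Sum.inr j) = 0 := by rw [← hbal]; simp [h0]
      rw [Finset.sum_eq_zero_iff_of_nonneg fun j _ => hx _] at this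
      simpa using this
    ext (i | j)
    · simp [h0]
    · simp [h1]
  · push Not at h0
    obtain ⟨i₀, hi₀⟩ := h0
    have h1 : ∃ j, x (Sum.inr j) ≠ 0 := by
      by_contra! h
      have : ∑ i, x (Sum.inl i) = 0 := by rw [hbal]; simp [h]
      rw [Finset.sum_eq_zero_iff_of_nonneg fun i _ => hx _] at this
      exact hi₀ (this i₀ (Finset.mem_univ _))
    obtain ⟨j₀, hj₀⟩ := h1
    obtain ⟨a, ha, hamax⟩ := Finset.exists_max_image {i | x (Sum.inl i) ≠ 0} p
      ⟨i₀, by simpa using hi₀⟩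
    obtain ⟨b, hb, hbmax⟩ := Finset.exists_max_image {j | x (Sum.inr j) ≠ 0} q
      ⟨j₀, by simpa using hj₀⟩
    simp only [Finset.mem_filter, Finset.mem_univ, true_and] at ha hamax hb hbmax
    -- Sending `δ` along (a, b) exhausts one of the two nodes, so the support shrinks.
    set δ := min (x (Sum.inl a)) (x (Sum.inr b)) with hδ
    have hδ0 : 0 ≤ δ := le_min (hx _) (hx _)
    let y : Fin n ⊕ Fin m → ℝ := x - δ • edgeVector (a, b)
    have yl : ∀ i, y (Sum.inl i) = x (Sum.inl i) - if i = a then δ else 0 := fun i => by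
      simp [y, column, incidence]
    have yr : ∀ j, y (Sum.inr j) = x (Sum.inr j) - if j = b then δ else 0 := fun j => by
      simp [y, column, incidence]
    have hy : ∀ z, 0 ≤ y z := by
      rintro (i | j)
      · rw [yl]
        split_ifs with h
        · subst h; exact sub_nonneg.2 (min_le_left _ _)
        · simpa using hx _
      · rw [yr]
        split_ifs with h
        · subst h; exact sub_nonneg.2 (min_le_right _ _)
        · simpa using hx _
    have hyx : ∀ z, y z ≠ 0 → x z ≠ 0 := by
      rintro (i | j) h h'
      · have := hy (Sum.inl i)
        rw [yl] at this h
        split_ifs at this h with hia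
        · exact ha (hia ▸ h')
        · simp [h'] at h
      · have := hy (Sum.inr j)
        rw [yr] at this h
        split_ifs at this h with hjb
        · exact hb (hjb ▸ h')
        · simp [h'] at h
    have hcard : Finset.card {z | y z ≠ 0} < N := by
      rw [← hN]
      refine Finset.card_lt_card ⟨fun z hz => by simpa using hyx z (by simpa using hz), fun hsub => ?_⟩
      rcases min_cases (x (Sum.inl a)) (x (Sum.inr b)) with ⟨h, -⟩ | ⟨h, -⟩
      · have := hsub (x := Sum.inl a) (by simpa using ha)
        simp [yl, hδ, h] at this
      · have := hsub (x := Sum.inr b) (by simpa using hb)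
        simp [yr, hδ, h] at this
    have hybal : ∑ i, y (Sum.inl i) = ∑ j, y (Sum.inr j) := by
      simp only [yl, yr, Finset.sum_sub_distrib, hbal]
      simp
    obtain ⟨f, hf, hfE, hfy⟩ := ih _ hcard y hy hybal rfl
    have hfl : ∀ e, f e ≠ 0 → x (Sum.inl e.1) ≠ 0 ∧ x (Sum.inr e.2) ≠ 0 := by
      rintro ⟨i, j⟩ he
      constructor
      · refine hyx _ (ne_of_gt ?_)
        rw [← hfy, sum_smul_edgeVector_inl]
        exact Finset.sum_pos' (fun _ _ => hf _) ⟨j, Finset.mem_univ _, (hf _).lt_of_ne' he⟩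
      · refine hyx _ (ne_of_gt ?_)
        rw [← hfy, sum_smul_edgeVector_inr]
        exact Finset.sum_pos' (fun _ _ => hf _) ⟨i, Finset.mem_univ _, (hf _).lt_of_ne' he⟩
    have hcases : ∀ e, f e + (if e = (a, b) then δ else 0) ≠ 0 → f e ≠ 0 ∨ e = (a, b) := by
      intro e he
      by_cases h : e = (a, b)
      · exact Or.inr h
      · exact Or.inl (by simpa [h] using he)
    refine ⟨fun e => f e + if e = (a, b) then δ else 0, fun e => ?_, ?_, ?_⟩
    · have := hf e
      positivity
    -- The new edge joins the last active nodes of both orders, so it crosses no edge of the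
    -- remaining flow.
    · intro e he e' he' hlt
      rcases hcases e he with he | rfl <;> rcases hcases e' he' with he' | rfl
      · exact hfE e he e' he' hlt
      · exact hbmax _ (hfl e he).2
      · exact absurd (hamax _ (hfl e' he').1) hlt.not_ge
      · exact le_rfl
    · simp only [add_smul, Finset.sum_add_distrib, hfy, ite_smul, zero_smul]
      simp [y]

theorem nonneg_and_balanced_of_mem_pos {x : Fin n ⊕ Fin m → ℝ} (hx : x ∈ pos (incidence n m)) :
    (∀ z, 0 ≤ x z) ∧ ∑ i, x (Sum.inl i) = ∑ j, x (Sum.inr j) := by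
  rw [pos, ← Set.image_univ, mem_hull_image_iff] at hx
  obtain ⟨f, hf, -, rfl⟩ := hx
  constructor
  · rintro (i | j)
    · rw [sum_smul_edgeVector_inl]
      exact Finset.sum_nonneg fun _ _ => hf _
    · rw [sum_smul_edgeVector_inr]
      exact Finset.sum_nonneg fun _ _ => hf _
  · simp only [sum_smul_edgeVector_inl, sum_smul_edgeVector_inr]
    exact Finset.sum_comm

/-- The staircase triangulation for the orders given by the ranks `p` and `q`. -/
def staircaseTriangulation (p : Fin n → ℕ) (q : Fin m → ℕ) :
    Set (PointedCone ℝ (Fin n ⊕ Fin m → ℝ)) :=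
  {σ | ∃ E, IsStaircase p q E ∧ PointedCone.hull ℝ (edgeVector '' E) = σ}

/-- Intersections are faces by uniqueness of flows: if x + y lies in both cones, its two flows
agree, so the flow of x is supported on both staircases. Covering is the north-west corner rule. -/
theorem staircaseTriangulation_isTriangulation {p : Fin n → ℕ} {q : Fin m → ℕ}
    (hp : p.Injective) (hq : q.Injective) :
    IsTriangulation (incidence n m) (staircaseTriangulation p q) := by
  have hinter : ∀ C ∈ staircaseTriangulation p q, ∀ D ∈ staircaseTriangulation p q,
      (C ⊓ D).IsFaceOf C := by
    rintro _ ⟨E, hE, rfl⟩ _ ⟨E', hE', rfl⟩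
    refine PointedCone.IsFaceOf.of_mem_of_add_mem_left inf_le_left ?_
    rintro x y hx hy ⟨-, hxy⟩
    refine ⟨hx, ?_⟩
    obtain ⟨f, hf, hfE, rfl⟩ := mem_hull_image_iff.1 hx
    obtain ⟨g, hg, hgE, rfl⟩ := mem_hull_image_iff.1 hy
    obtain ⟨h, hh, hhE, hsum⟩ := mem_hull_image_iff.1 hxy
    have heq : f + g = h := by
      refine hE.flow_unique hp hq hE' (fun e => add_nonneg (hf e) (hg e)) hh (fun e he => ?_) hhE ?_
      · by_contra h'
        exact he (by simp [not_not.1 (mt (hfE e) h'), not_not.1 (mt (hgE e) h')])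
      · rw [hsum]
        simp [add_smul, Finset.sum_add_distrib]
    refine mem_hull_image_iff.2 ⟨f, hf, fun e he => hhE e ?_, rfl⟩
    rw [← heq]
    exact (add_pos_of_pos_of_nonneg ((hf e).lt_of_ne' he) (hg e)).ne'
  refine ⟨⟨?_, ?_, ?_, hinter, fun C hC D hD => inf_comm C D ▸ hinter D hD C hC⟩, ?_, ?_⟩
  · exact (Set.toFinite (Set.range fun E : Set (Fin n × Fin m) =>
      PointedCone.hull ℝ (edgeVector '' E))).subset fun σ ⟨E, _, h⟩ => ⟨E, h⟩
  · rintro _ ⟨E, hE, rfl⟩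
    exact isPolyhedralCone_hull (hE.linearIndepOn hp hq).id_image
  · rintro _ ⟨E, hE, rfl⟩ F hF
    exact ⟨_, fun e he e' he' => hE e he.1 e' he'.1, (eq_hull_of_isFaceOf_hull_image hF).symm⟩
  · ext x
    simp only [Set.mem_iUnion, exists_prop]
    constructor
    · rintro ⟨_, ⟨E, hE, rfl⟩, hx⟩
      exact Submodule.span_mono (Set.image_subset_range _ _) hx
    · intro hx
      obtain ⟨h1, h2⟩ := nonneg_and_balanced_of_mem_pos hx
      obtain ⟨f, hf, hfE, hfx⟩ := exists_staircase_flow p q x h1 h2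
      exact ⟨_, ⟨_, hfE, rfl⟩, mem_hull_image_iff.2 ⟨f, hf, fun e he => he, hfx⟩⟩
  · rintro _ ⟨E, hE, rfl⟩
    exact ⟨_, Set.image_subset_range _ _, (hE.linearIndepOn hp hq).id_image, rfl⟩

end Staircase

/-! ### Cut hyperplanes and the chambers of generic points -/

section Cuts

variable {n m : ℕ}

/-- The linear form which sends `u × v` to `∑_{i ∈ P} u_i - ∑_{j ∈ Q} v_j`. -/
def cutValue (P : Finset (Fin n)) (Q : Finset (Fin m)) : (Fin n ⊕ Fin m → ℝ) →ₗ[ℝ] ℝ :=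
  ∑ i ∈ P, LinearMap.proj (Sum.inl i) - ∑ j ∈ Q, LinearMap.proj (Sum.inr j)

theorem cutValue_apply (P : Finset (Fin n)) (Q : Finset (Fin m)) (x : Fin n ⊕ Fin m → ℝ) :
    cutValue P Q x = ∑ i ∈ P, x (Sum.inl i) - ∑ j ∈ Q, x (Sum.inr j) := by
  simp [cutValue, LinearMap.sum_apply]

theorem cutValue_edgeVector (P : Finset (Fin n)) (Q : Finset (Fin m)) (e : Fin n × Fin m) :
    cutValue P Q (edgeVector e) = (if e.1 ∈ P then 1 else 0) - (if e.2 ∈ Q then 1 else 0) := by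
  simp [cutValue_apply, column, incidence]

/-- The space spanned by the edges: the points `u × v` with `∑ u_i = ∑ v_j`. -/
def balanced (n m : ℕ) : Submodule ℝ (Fin n ⊕ Fin m → ℝ) :=
  LinearMap.ker (cutValue Finset.univ Finset.univ)

theorem mem_balanced {x : Fin n ⊕ Fin m → ℝ} :
    x ∈ balanced n m ↔ ∑ i, x (Sum.inl i) = ∑ j, x (Sum.inr j) := by
  rw [balanced, LinearMap.mem_ker, cutValue_apply, sub_eq_zero]

theorem edgeVector_mem_balanced (e : Fin n × Fin m) : edgeVector e ∈ balanced n m := by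
  rw [balanced, LinearMap.mem_ker, cutValue_edgeVector]
  simp

theorem cutForm_eq {x : Fin n ⊕ Fin m → ℝ} (hx : x ∈ balanced n m) (P : Finset (Fin n))
    (Q : Finset (Fin m)) : cutForm P Q x = 2 * cutValue P Q x := by
  rw [mem_balanced, ← Finset.sum_add_sum_compl P, ← Finset.sum_add_sum_compl Q] at hx
  simp only [cutForm, cutValue_apply, LinearMap.add_apply, LinearMap.sub_apply,
    LinearMap.sum_apply, LinearMap.proj_apply]
  linarith

theorem cutValue_compl {x : Fin n ⊕ Fin m → ℝ} (hx : x ∈ balanced n m) (P : Finset (Fin n))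
    (Q : Finset (Fin m)) : cutValue Pᶜ Qᶜ x = - cutValue P Q x := by
  rw [mem_balanced, ← Finset.sum_add_sum_compl P, ← Finset.sum_add_sum_compl Q] at hx
  simp only [cutValue_apply]
  linarith

theorem pos_incidence_le_balanced {x : Fin n ⊕ Fin m → ℝ} (hx : x ∈ pos (incidence n m)) :
    x ∈ balanced n m :=
  mem_balanced.2 (nonneg_and_balanced_of_mem_pos hx).2

theorem mem_pos_incidence {x : Fin n ⊕ Fin m → ℝ} (hx : ∀ z, 0 ≤ x z) (hx' : x ∈ balanced n m) :
    x ∈ pos (incidence n m) := by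
  obtain ⟨f, hf, -, hfx⟩ := exists_staircase_flow (fun _ => 0) (fun _ => 0) x hx
    (mem_balanced.1 hx')
  rw [pos, ← Set.image_univ]
  exact mem_hull_image_iff.2 ⟨f, hf, fun _ _ => Set.mem_univ _, hfx⟩

/-- A set of edges which does not span is disconnected: it misses both sides of some cut. -/
theorem exists_cut_of_not_balanced_le_span (hn : 0 < n) {S : Set (Fin n ⊕ Fin m → ℝ)}
    (hS : S ⊆ Set.range edgeVector) (hspan : ¬ balanced n m ≤ Submodule.span ℝ S) :
    ∃ (P : Finset (Fin n)) (Q : Finset (Fin m)), P.Nonempty ∧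
      ¬ (P = Finset.univ ∧ Q = Finset.univ) ∧ ∀ s ∈ S, cutValue P Q s = 0 := by
  classical
  obtain ⟨w, hw, hwS⟩ := SetLike.not_le_iff_exists.1 hspan
  obtain ⟨φ, hφw, hφ⟩ := Submodule.exists_le_ker_of_notMem hwS
  let a : Fin n → ℝ := fun i => φ (Pi.single (Sum.inl i) 1)
  -- With this sign, `φ` kills an edge exactly when its ends have equal potential; a level set of
  -- the potentials is then a union of components of the graph of `S`.
  let b : Fin m → ℝ := fun j => - φ (Pi.single (Sum.inr j) 1)
  have hφx : ∀ x, φ x = ∑ i, x (Sum.inl i) * a i - ∑ j, x (Sum.inr j) * b j := fun x => by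
    conv_lhs => rw [pi_eq_sum_univ' x]
    simp [a, b, Fintype.sum_sum_type]
  have hedge : ∀ e : Fin n × Fin m, edgeVector e ∈ S → a e.1 = b e.2 := fun e he => by
    have : φ (edgeVector e) = 0 := hφ (Submodule.subset_span he)
    rw [hφx] at this
    simpa [column, incidence, sub_eq_zero] using this
  refine ⟨Finset.univ.filter fun i => a i = a ⟨0, hn⟩,
    Finset.univ.filter fun j => b j = a ⟨0, hn⟩, ⟨⟨0, hn⟩, by simp⟩, ?_, ?_⟩
  · rintro ⟨hP, hQ⟩
    rw [Finset.filter_eq_self] at hP hQ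
    apply hφw
    rw [hφx, Finset.sum_congr rfl fun i hi => by rw [hP i hi],
      Finset.sum_congr (s₁ := (Finset.univ : Finset (Fin m))) rfl fun j hj => by rw [hQ j hj],
      ← Finset.sum_mul, ← Finset.sum_mul, mem_balanced.1 hw, sub_self]
  · intro s hs
    obtain ⟨e, rfl⟩ := hS hs
    rw [cutValue_edgeVector]
    simp [hedge e hs]

/-- A point is generic if it lies on no cut hyperplane. -/
def IsGeneric (c : Fin n ⊕ Fin m → ℝ) : Prop :=
  ∀ (P : Finset (Fin n)) (Q : Finset (Fin m)), P.Nonempty → cutValue P Q c = 0 →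
    P = Finset.univ ∧ Q = Finset.univ

/-- The balanced points which no cut hyperplane separates strictly from `c`. -/
def cutRegion (c : Fin n ⊕ Fin m → ℝ) : Set (Fin n ⊕ Fin m → ℝ) :=
  {y | y ∈ balanced n m ∧ ∀ P Q, 0 ≤ cutValue P Q c * cutValue P Q y}

/-- Genericity forces `S` to span. Removing one generator s leaves a cut vanishing on the others,
whose value at a point is the s-coefficient times its value at s. Since y is not separated from c,
its coefficient is nonnegative. -/
theorem cutRegion_subset_hull (hn : 0 < n) {c : Fin n ⊕ Fin m → ℝ} (hc : IsGeneric c)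
    {S : Set (Fin n ⊕ Fin m → ℝ)} (hS : S ⊆ Set.range edgeVector) (hli : LinearIndepOn ℝ id S)
    (hcS : c ∈ PointedCone.hull ℝ S) {y : Fin n ⊕ Fin m → ℝ} (hy : y ∈ cutRegion c) :
    y ∈ PointedCone.hull ℝ S := by
  classical
  have hspan : balanced n m ≤ Submodule.span ℝ S := by
    by_contra h
    obtain ⟨P, Q, hP, hPQ, hcut⟩ := exists_cut_of_not_balanced_le_span hn hS h
    have hle : Submodule.span ℝ S ≤ LinearMap.ker (cutValue P Q) := Submodule.span_le.2 hcut
    exact hPQ (hc P Q hP (hle (PointedCone.hull_le_span ℝ S hcS)))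
  have hfin : S.Finite := (Set.finite_range _).subset hS
  lift S to Finset (Fin n ⊕ Fin m → ℝ) using hfin
  obtain ⟨a, -, rfl⟩ := Submodule.mem_span_finset.1 (hspan hy.1)
  obtain ⟨d, -, hd⟩ := Submodule.mem_span_finset.1 hcS
  have hd' : ∑ s ∈ S, (d s : ℝ) • s = c := hd
  refine Submodule.sum_mem _ fun s hs => PointedCone.smul_mem _ ?_ (PointedCone.subset_hull hs)
  have hcut : ¬ balanced n m ≤ Submodule.span ℝ ((S : Set (Fin n ⊕ Fin m → ℝ)) \ {s}) := by
    intro h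
    obtain ⟨e, rfl⟩ := hS hs
    have := hli.notMem_span hs
    rw [Set.image_id] at this
    exact this (h (edgeVector_mem_balanced e))
  obtain ⟨P, Q, hP, hPQ, hcut⟩ :=
    exists_cut_of_not_balanced_le_span hn (Set.sdiff_subset.trans hS) hcut
  have hval : ∀ r : (Fin n ⊕ Fin m → ℝ) → ℝ,
      cutValue P Q (∑ t ∈ S, r t • t) = r s * cutValue P Q s := fun r => by
    rw [map_sum, Finset.sum_eq_single_of_mem s hs]
    · simp
    · intro t ht hts
      rw [map_smul, hcut t ⟨ht, hts⟩, smul_zero]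
  have hne : cutValue P Q c ≠ 0 := fun h => hPQ (hc P Q hP h)
  have hprod := hy.2 P Q
  rw [hval a] at hprod
  rw [← hd', hval fun t => d t] at hprod hne
  have hds : 0 < (d s : ℝ) := (d s).2.lt_of_ne' (left_ne_zero_of_mul hne)
  have hsq : 0 < cutValue P Q s * cutValue P Q s := mul_self_pos.2 (right_ne_zero_of_mul hne)
  have : 0 ≤ (d s * (cutValue P Q s * cutValue P Q s)) * a s := by linarith
  exact nonneg_of_mul_nonneg_right this (mul_pos hds hsq)

/-- Of the finitely many inequalities, those strict at `y` survive a small move, and the tight ones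
do not change along `w`. -/
theorem exists_add_smul_mem_cutRegion {c y w : Fin n ⊕ Fin m → ℝ} (hy : y ∈ cutRegion c)
    (hw : w ∈ balanced n m)
    (hzero : ∀ P Q, cutValue P Q c ≠ 0 → cutValue P Q y = 0 → cutValue P Q w = 0) :
    ∃ ε : ℝ, 0 < ε ∧ y + ε • w ∈ cutRegion c := by
  have key : ∀ᶠ ε in nhdsWithin (0 : ℝ) (Set.Ioi 0),
      ∀ PQ : Finset (Fin n) × Finset (Fin m),
        0 ≤ cutValue PQ.1 PQ.2 c * cutValue PQ.1 PQ.2 (y + ε • w) := by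
    rw [Filter.eventually_all]
    rintro ⟨P, Q⟩
    simp only [map_add, map_smul, smul_eq_mul]
    rcases (hy.2 P Q).eq_or_lt with h | h
    · refine Filter.Eventually.of_forall fun ε => ?_
      rcases mul_eq_zero.1 h.symm with h' | h'
      · simp [h']
      · by_cases hc : cutValue P Q c = 0
        · simp [hc]
        · simp [h', hzero P Q hc h']
    · have hcont : Continuous fun ε : ℝ =>
          cutValue P Q c * (cutValue P Q y + ε * cutValue P Q w) := by fun_prop
      have := (hcont.tendsto 0).eventually (lt_mem_nhds (by simpa using h))
      exact (this.filter_mono nhdsWithin_le_nhds).mono fun ε hε => hε.le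
  obtain ⟨ε, hε, hε0⟩ := (key.and self_mem_nhdsWithin).exists
  exact ⟨ε, hε0, (balanced n m).add_mem hy.1 ((balanced n m).smul_mem ε hw),
    fun P Q => hε (P, Q)⟩

theorem self_mem_cutRegion {c : Fin n ⊕ Fin m → ℝ} (hc : c ∈ balanced n m) : c ∈ cutRegion c :=
  ⟨hc, fun _ _ => mul_self_nonneg _⟩

theorem exists_self_add_smul_mem_cutRegion {c w : Fin n ⊕ Fin m → ℝ} (hc : c ∈ balanced n m)
    (hw : w ∈ balanced n m) : ∃ ε : ℝ, 0 < ε ∧ c + ε • w ∈ cutRegion c :=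
  exists_add_smul_mem_cutRegion (self_mem_cutRegion hc) hw fun _ _ h h' => absurd h' h

theorem exists_isTriangulation_incidence : ∃ T, IsTriangulation (incidence n m) T :=
  ⟨_, staircaseTriangulation_isTriangulation Fin.val_injective Fin.val_injective⟩

theorem cutRegion_subset_of_mem_chamberComplex (hn : 0 < n) {c : Fin n ⊕ Fin m → ℝ}
    (hc : IsGeneric c) {C : PointedCone ℝ (Fin n ⊕ Fin m → ℝ)}
    (hC : C ∈ chamberComplex (incidence n m)) (hcC : c ∈ C) : cutRegion c ⊆ C := by
  obtain ⟨f, hf, rfl⟩ := hC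
  intro y hy
  refine Submodule.mem_iInf _ |>.2 fun T => ?_
  have hcT := Submodule.mem_iInf _ |>.1 hcC T
  obtain ⟨S, hS, hli, hSf⟩ := T.2.simplicial _ (hf T)
  rw [← hSf] at hcT ⊢
  exact cutRegion_subset_hull hn hc hS hli hcT hy

theorem le_pos_of_mem_chamberComplex {C : PointedCone ℝ (Fin n ⊕ Fin m → ℝ)}
    (hC : C ∈ chamberComplex (incidence n m)) : C ≤ pos (incidence n m) := by
  have h := (chamberComplex_isChamberComplex (exists_isTriangulation_incidence (n := n) (m := m)))
  intro x hx
  have := h.1.covers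
  rw [← SetLike.mem_coe, ← this]
  exact Set.mem_biUnion hC hx

theorem span_eq_balanced {c : Fin n ⊕ Fin m → ℝ} (hc : c ∈ balanced n m)
    {C : PointedCone ℝ (Fin n ⊕ Fin m → ℝ)} (hCle : ∀ x ∈ C, x ∈ balanced n m)
    (hC : cutRegion c ⊆ C) : Submodule.span ℝ (C : Set (Fin n ⊕ Fin m → ℝ)) = balanced n m := by
  refine le_antisymm (Submodule.span_le.2 hCle) fun w hw => ?_
  obtain ⟨ε, hε, hmem⟩ := exists_self_add_smul_mem_cutRegion hc hw
  have h1 := Submodule.subset_span (R := ℝ) (hC hmem)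
  have h2 := Submodule.subset_span (R := ℝ) (hC (self_mem_cutRegion hc))
  have h3 := Submodule.sub_mem _ h1 h2
  rw [add_sub_cancel_left] at h3
  exact (Submodule.smul_mem_iff _ hε.ne').1 h3

theorem exists_chamber_of_isGeneric (hn : 0 < n) {c : Fin n ⊕ Fin m → ℝ} (hc : IsGeneric c)
    (hcpos : c ∈ pos (incidence n m)) : ∃ C ∈ chamberComplex (incidence n m), c ∈ C ∧
      cutRegion c ⊆ C := by
  have h := (chamberComplex_isChamberComplex (exists_isTriangulation_incidence (n := n) (m := m)))
  have hcov := h.1.covers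
  rw [← SetLike.mem_coe, ← hcov] at hcpos
  simp only [Set.mem_iUnion, exists_prop] at hcpos
  obtain ⟨C, hC, hcC⟩ := hcpos
  exact ⟨C, hC, hcC, cutRegion_subset_of_mem_chamberComplex hn hc hC hcC⟩

/-- A generic point lies in exactly one chamber. -/
theorem chamber_unique (hn : 0 < n) {c : Fin n ⊕ Fin m → ℝ} (hc : IsGeneric c)
    (hcbal : c ∈ balanced n m) {C D : PointedCone ℝ (Fin n ⊕ Fin m → ℝ)}
    (hC : C ∈ chamberComplex (incidence n m)) (hD : D ∈ chamberComplex (incidence n m))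
    (hcC : c ∈ C) (hcD : c ∈ D) : C ≤ D := by
  have h := (chamberComplex_isChamberComplex (exists_isTriangulation_incidence (n := n) (m := m)))
  have hface := h.1.complex.inter_left C hC D hD
  intro x hx
  -- Moving from c slightly away from x stays in C, so c is interior to a segment ending at x; the
  -- face `C ⊓ D` contains c, hence x.
  obtain ⟨ε, hε, hmem⟩ := exists_self_add_smul_mem_cutRegion hcbal
    ((balanced n m).neg_mem (pos_incidence_le_balanced (le_pos_of_mem_chamberComplex hC hx)))
  refine (hface.mem_of_smul_add_mem hx
    (cutRegion_subset_of_mem_chamberComplex hn hc hC hcC hmem) hε ?_).2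
  rw [smul_neg, add_comm, neg_add_cancel_right]
  exact ⟨hcC, hcD⟩

/-- The ranks of an order in which the members of `P` come first. -/
def rankFirst {N : ℕ} (P : Finset (Fin N)) (i : Fin N) : ℕ := if i ∈ P then i else N + i

theorem rankFirst_injective {N : ℕ} (P : Finset (Fin N)) : (rankFirst P).Injective := by
  intro i j h
  have := i.2
  have := j.2
  apply Fin.ext
  unfold rankFirst at h
  split_ifs at h <;> omega

theorem rankFirst_lt {N : ℕ} {P : Finset (Fin N)} {i j : Fin N} (hi : i ∈ P) (hj : j ∉ P) :
    rankFirst P i < rankFirst P j := by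
  have := i.2
  simp only [rankFirst, hi, hj, if_true, if_false]
  omega

/-- A positive value requires an edge from P to the complement of Q. It would cross any edge from
the complement of P to Q, and only those contribute negatively. -/
theorem cutValue_nonneg_of_isStaircase {P : Finset (Fin n)} {Q : Finset (Fin m)}
    {E : Set (Fin n × Fin m)} (hE : IsStaircase (rankFirst P) (rankFirst Q) E)
    {x y : Fin n ⊕ Fin m → ℝ} (hx : x ∈ PointedCone.hull ℝ (edgeVector '' E))
    (hy : y ∈ PointedCone.hull ℝ (edgeVector '' E)) (hpos : 0 < cutValue P Q x) :
    0 ≤ cutValue P Q y := by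
  obtain ⟨f, hf, hfE, rfl⟩ := mem_hull_image_iff.1 hx
  obtain ⟨g, hg, hgE, rfl⟩ := mem_hull_image_iff.1 hy
  simp only [map_sum, map_smul, smul_eq_mul, cutValue_edgeVector] at hpos ⊢
  obtain ⟨e, -, he⟩ := Finset.exists_lt_of_sum_lt
    (by simpa using hpos : ∑ e : Fin n × Fin m, (0 : ℝ) < _)
  have heE := hfE e (left_ne_zero_of_mul he.ne')
  have he' := pos_of_mul_pos_right he (hf e)
  have h1 : e.1 ∈ P := by
    by_contra h
    rw [if_neg h] at he'
    split_ifs at he' <;> norm_num at he'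
  have h2 : e.2 ∉ Q := by
    intro h
    simp [h, h1] at he'
  refine Finset.sum_nonneg fun e' _ => ?_
  by_cases hge : g e' = 0
  · simp [hge]
  · refine mul_nonneg (hg e') ?_
    by_cases h1' : e'.1 ∈ P
    · rw [if_pos h1']
      split_ifs <;> norm_num
    · have h2' : e'.2 ∉ Q := fun h =>
        (rankFirst_lt h h2).not_ge (hE e heE e' (hgE e' hge) (rankFirst_lt h1 h1'))
      simp [h1', h2']

theorem cutValue_nonneg_of_mem_chamberComplex {P : Finset (Fin n)} {Q : Finset (Fin m)}
    {C : PointedCone ℝ (Fin n ⊕ Fin m → ℝ)} (hC : C ∈ chamberComplex (incidence n m))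
    {x y : Fin n ⊕ Fin m → ℝ} (hx : x ∈ C) (hy : y ∈ C) (hpos : 0 < cutValue P Q x) :
    0 ≤ cutValue P Q y := by
  have h := (chamberComplex_isChamberComplex (exists_isTriangulation_incidence (n := n) (m := m)))
  obtain ⟨_, ⟨E, hE, rfl⟩, hle⟩ := h.1.refines _ (staircaseTriangulation_isTriangulation
    (rankFirst_injective P) (rankFirst_injective Q)) C hC
  exact cutValue_nonneg_of_isStaircase hE (hle hx) (hle hy) hpos

end Cuts

/-! ### A criterion for facets of a chamber -/

section Facets

variable {n m : ℕ}

theorem mem_cutSection {C : PointedCone ℝ (Fin n ⊕ Fin m → ℝ)}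
    (hC : ∀ x ∈ C, x ∈ balanced n m) {P : Finset (Fin n)} {Q : Finset (Fin m)}
    {x : Fin n ⊕ Fin m → ℝ} : x ∈ cutSection C P Q ↔ x ∈ C ∧ cutValue P Q x = 0 := by
  rw [cutSection, Submodule.mem_inf]
  refine and_congr_right fun hx => ?_
  rw [PointedCone.mem_ofSubmodule_iff, cutHyperplane, LinearMap.mem_ker, cutForm_eq (hC x hx)]
  simp

theorem finrank_inf_ker_add_one {V : Type*} [AddCommGroup V] [Module ℝ V] [FiniteDimensional ℝ V]
    {W : Submodule ℝ V} {φ : V →ₗ[ℝ] ℝ} {c : V} (hc : c ∈ W) (hφ : φ c ≠ 0) :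
    Module.finrank ℝ (W ⊓ LinearMap.ker φ : Submodule ℝ V) + 1 = Module.finrank ℝ W := by
  have hne : φ.domRestrict W ≠ 0 := fun h => hφ (LinearMap.congr_fun h ⟨c, hc⟩)
  rw [← Module.Dual.finrank_ker_add_one_of_ne_zero hne, ← Submodule.finrank_map_subtype_eq]
  congr 1
  have : (LinearMap.ker (φ.domRestrict W)).map W.subtype = W ⊓ LinearMap.ker φ := by
    ext x
    simp [and_comm]
  rw [← this]

/-- If the chamber of `c` has a point which lies on exactly one cut hyperplane and is not separated
from `c` by another one, then this hyperplane meets the chamber in a facet. -/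
theorem cutSection_isFacet {P : Finset (Fin n)} {Q : Finset (Fin m)}
    {C : PointedCone ℝ (Fin n ⊕ Fin m → ℝ)} (hC : ∀ x ∈ C, x ∈ balanced n m)
    (hnonneg : ∀ x ∈ C, 0 ≤ cutValue P Q x) {c y : Fin n ⊕ Fin m → ℝ} (hc : c ∈ balanced n m)
    (hcC : cutRegion c ⊆ C) (hcne : cutValue P Q c ≠ 0) (hy : y ∈ cutRegion c)
    (hyPQ : cutValue P Q y = 0)
    (hywall : ∀ w ∈ balanced n m, cutValue P Q w = 0 →
      ∀ P' Q', cutValue P' Q' c ≠ 0 → cutValue P' Q' y = 0 → cutValue P' Q' w = 0) :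
    IsFacet (cutSection C P Q) C := by
  constructor
  · refine PointedCone.IsFaceOf.of_mem_of_add_mem_left inf_le_left fun {x z} hx hz hxz => ?_
    rw [mem_cutSection hC] at hxz ⊢
    have h1 := hnonneg x hx
    have h2 := hnonneg z hz
    have h3 := hxz.2
    rw [map_add] at h3
    exact ⟨hx, by linarith⟩
  · have hspan : Submodule.span ℝ (cutSection C P Q : Set (Fin n ⊕ Fin m → ℝ)) =
        balanced n m ⊓ LinearMap.ker (cutValue P Q) := by
      refine le_antisymm (Submodule.span_le.2 fun x hx => ?_) ?_
      · have := (mem_cutSection hC).1 hx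
        exact ⟨hC x this.1, this.2⟩
      · rintro w ⟨hw, hwker⟩
        have hwker' : cutValue P Q w = 0 := hwker
        obtain ⟨ε, hε, hmem⟩ := exists_add_smul_mem_cutRegion hy hw (hywall w hw hwker)
        have h1 : y ∈ cutSection C P Q := (mem_cutSection hC).2 ⟨hcC hy, hyPQ⟩
        have h2 : y + ε • w ∈ cutSection C P Q :=
          (mem_cutSection hC).2 ⟨hcC hmem, by simp [hyPQ, hwker']⟩
        have h3 := Submodule.sub_mem _ (Submodule.subset_span (R := ℝ) h2)
          (Submodule.subset_span (R := ℝ) h1)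
        rw [add_sub_cancel_left] at h3
        exact (Submodule.smul_mem_iff _ hε.ne').1 h3
    rw [coneDim, coneDim, hspan, span_eq_balanced hc hC hcC]
    exact finrank_inf_ker_add_one hc hcne

end Facets

/-! ### The central chamber and its facets of type (k, k + 1) -/

section Center

variable {k n m : ℕ}

theorem cutValue_center (hn : 0 < n) (hm : 0 < m) (P : Finset (Fin n)) (Q : Finset (Fin m)) :
    (n * m : ℝ) * cutValue P Q (center n m) = ((m * P.card - n * Q.card : ℤ) : ℝ) := by
  have hn' : (n : ℝ) ≠ 0 := by positivity
  have hm' : (m : ℝ) ≠ 0 := by positivity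
  simp only [cutValue_apply, center, Sum.elim_inl, Sum.elim_inr, Finset.sum_const, nsmul_eq_mul]
  push_cast
  field_simp

theorem center_mem_balanced (hn : 0 < n) (hm : 0 < m) : center n m ∈ balanced n m := by
  have hn' : (n : ℝ) ≠ 0 := by positivity
  have hm' : (m : ℝ) ≠ 0 := by positivity
  rw [mem_balanced]
  simp [center, hn', hm']

theorem center_mem_pos (hn : 0 < n) (hm : 0 < m) : center n m ∈ pos (incidence n m) := by
  refine mem_pos_incidence ?_ (center_mem_balanced hn hm)
  rintro (i | j) <;> simp [center]

theorem isGeneric_center (hn : 0 < n) (hm : 0 < m) (hcop : n.Coprime m) :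
    IsGeneric (center n m) := by
  intro P Q hP h0
  have h := cutValue_center hn hm P Q
  rw [h0, mul_zero] at h
  have h' : m * P.card = n * Q.card := by
    have : (m * P.card - n * Q.card : ℤ) = 0 := by exact_mod_cast h.symm
    exact_mod_cast sub_eq_zero.1 this
  have hdvd : n ∣ P.card := hcop.dvd_of_dvd_mul_left ⟨_, h'⟩
  have hPn : P.card = n := by
    refine le_antisymm (by simpa using P.card_le_univ) (Nat.le_of_dvd hP.card_pos hdvd)
  have hQm : Q.card = m := by
    rw [hPn, mul_comm] at h'
    exact (Nat.eq_of_mul_eq_mul_left hn h').symm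
  exact ⟨(Finset.card_eq_iff_eq_univ _).1 (by simpa using hPn),
    (Finset.card_eq_iff_eq_univ _).1 (by simpa using hQm)⟩

/-- A point of the central chamber which lies in the relative interior of the facet of the cut
given by `P` and `Q`. -/
def facetPoint (k : ℕ) (P : Finset (Fin n)) (Q : Finset (Fin m)) : Fin n ⊕ Fin m → ℝ :=
  Sum.elim (fun i => k * m - if i ∈ P then 1 else 0) (fun j => k * n - if j ∈ Q then 0 else 1)

/-- The point is knm times the center, minus the indicators of P and of the complement of Q. So the
integer m|P'| - n|Q'| governing the center appears k-fold, with a perturbation that changes it by at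
most k when those two sets have k elements. -/
theorem cutValue_facetPoint (k : ℕ) (P P' : Finset (Fin n)) (Q Q' : Finset (Fin m)) :
    cutValue P' Q' (facetPoint k P Q) =
      ((k * (m * P'.card - n * Q'.card) - (P' ∩ P).card + (Q' \ Q).card : ℤ) : ℝ) := by
  have h1 : ∑ i ∈ P', (if i ∈ P then (1 : ℝ) else 0) = (P' ∩ P).card := by
    rw [Finset.sum_ite_mem]; simp
  have h2 : ∑ j ∈ Q', (if j ∈ Q then (0 : ℝ) else 1) = (Q' \ Q).card := by
    rw [Finset.sum_ite, ← Finset.sdiff_eq_filter]; simp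
  simp only [cutValue_apply, facetPoint, Sum.elim_inl, Sum.elim_inr, Finset.sum_sub_distrib, h1, h2,
    Finset.sum_const, nsmul_eq_mul]
  push_cast
  ring

theorem facetPoint_mem_balanced {P : Finset (Fin n)} {Q : Finset (Fin m)} (hP : P.card = k)
    (hQ : Q.card + k = m) : facetPoint k P Q ∈ balanced n m := by
  rw [balanced, LinearMap.mem_ker, cutValue_facetPoint]
  have h : (Finset.univ \ Q).card = k := by
    rw [← Finset.compl_eq_univ_sdiff, Finset.card_compl, Fintype.card_fin]
    omega
  rw [h, Finset.univ_inter, hP, Finset.card_fin, Finset.card_fin]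
  push_cast
  ring

theorem card_sdiff_le {Q Q' : Finset (Fin m)} (hQ : Q.card + k = m) :
    (Q' \ Q).card ≤ k := by
  have : (Q' \ Q).card ≤ Qᶜ.card :=
    Finset.card_le_card fun j hj => by simpa using (Finset.mem_sdiff.1 hj).2
  rw [Finset.card_compl, Fintype.card_fin] at this
  omega

theorem facetPoint_mem_cutRegion (hn : 0 < n) (hm : 0 < m) {P : Finset (Fin n)}
    {Q : Finset (Fin m)} (hP : P.card = k) (hQ : Q.card + k = m) :
    facetPoint k P Q ∈ cutRegion (center n m) := by
  refine ⟨facetPoint_mem_balanced hP hQ, fun P' Q' => ?_⟩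
  have hnm : (0 : ℝ) < n * m := by positivity
  have h1 : (P' ∩ P).card ≤ k := hP ▸ Finset.card_le_card Finset.inter_subset_right
  have h2 : (Q' \ Q).card ≤ k := card_sdiff_le hQ
  have h : (0 : ℝ) ≤ (n * m) * (cutValue P' Q' (center n m) * cutValue P' Q' (facetPoint k P Q)) := by
    rw [← mul_assoc, cutValue_center hn hm, cutValue_facetPoint,
      ← Int.cast_mul]
    refine Int.cast_nonneg ?_
    -- As an integer, a nonzero `G` has |G| ≥ 1, so k|G| outweighs either correction term.
    set G : ℤ := m * P'.card - n * Q'.card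
    rcases lt_trichotomy G 0 with hG | hG | hG
    · refine mul_nonneg_of_nonpos_of_nonpos hG.le ?_
      have : (k : ℤ) * (G + 1) ≤ 0 := mul_nonpos_of_nonneg_of_nonpos (by positivity) (by omega)
      have : (k : ℤ) * (G + 1) = k * G + k := by ring
      omega
    · simp [hG]
    · refine mul_nonneg hG.le ?_
      have : 0 ≤ (k : ℤ) * (G - 1) := mul_nonneg (by positivity) (by omega)
      have : (k : ℤ) * (G - 1) = k * G - k := by ring
      omega
  exact nonneg_of_mul_nonneg_right h hnm

/-- Vanishing forces m|P'| - n|Q'| = 1 and extremal corrections, so P ⊆ P' and Q' ⊆ Q. As (k, k + 1)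
already gives the value 1, any excess s of P' or deficit t of Q' would make ms + nt positive instead
of zero. -/
theorem eq_of_cutValue_facetPoint_eq_zero (hk : 1 ≤ k) (hn : n + 1 = 2 * k) (hm : m = 2 * k + 1)
    {P P' : Finset (Fin n)} {Q Q' : Finset (Fin m)} (hP : P.card = k) (hQ : Q.card = k + 1)
    (hpos : 0 < cutValue P' Q' (center n m)) (hzero : cutValue P' Q' (facetPoint k P Q) = 0) :
    P' = P ∧ Q' = Q := by
  have hn0 : 0 < n := by omega
  have hm0 : 0 < m := by omega
  have hnm : (0 : ℝ) < n * m := by positivity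
  have h1 : (P' ∩ P).card ≤ k := hP ▸ Finset.card_le_card Finset.inter_subset_right
  have h2 : (Q' \ Q).card ≤ k := card_sdiff_le (by omega)
  have hG := mul_pos hnm hpos
  rw [cutValue_center hn0 hm0] at hG
  rw [cutValue_facetPoint] at hzero
  replace hG := Int.cast_pos.1 hG
  replace hzero := Int.cast_eq_zero.1 hzero
  have hG1 : (m * P'.card - n * Q'.card : ℤ) = 1 := by
    set G : ℤ := m * P'.card - n * Q'.card
    by_contra hne
    have : 0 ≤ (k : ℤ) * (G - 2) := mul_nonneg (by positivity) (by omega)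
    have : (k : ℤ) * (G - 2) = k * G - 2 * k := by ring
    have h3 : k ≤ (P' ∩ P).card := by omega
    have h4 : (Q' \ Q).card = 0 := by omega
    omega
  rw [hG1] at hzero
  have h3 : (P' ∩ P).card = k := by omega
  have h4 : (Q' \ Q).card = 0 := by omega
  have hPP : P ⊆ P' := by
    have : P' ∩ P = P := Finset.eq_of_subset_of_card_le Finset.inter_subset_right (by omega)
    exact this ▸ Finset.inter_subset_left
  have hQQ : Q' ⊆ Q := Finset.sdiff_eq_empty_iff_subset.1 (Finset.card_eq_zero.1 h4)
  have hPc := Finset.card_le_card hPP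
  have hQc := Finset.card_le_card hQQ
  have hn' : (n : ℤ) = 2 * k - 1 := by omega
  have hm' : (m : ℤ) = 2 * k + 1 := by omega
  obtain ⟨s, hs⟩ := Nat.exists_eq_add_of_le hPc
  obtain ⟨t, ht⟩ := Nat.exists_eq_add_of_le hQc
  have hsum : (m : ℤ) * s + n * t = 0 := by
    have e1 : (P'.card : ℤ) = k + s := by omega
    have e2 : (Q'.card : ℤ) = k + 1 - t := by omega
    rw [e1, e2] at hG1
    rw [hn', hm'] at hG1 ⊢
    linarith
  have hs0 : s = 0 := by
    by_contra h
    have : 0 < (m : ℤ) * s := by positivity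
    have : 0 ≤ (n : ℤ) * t := by positivity
    omega
  have ht0 : t = 0 := by
    by_contra h
    have : 0 ≤ (m : ℤ) * s := by positivity
    have : 0 < (n : ℤ) * t := by positivity
    omega
  exact ⟨(Finset.eq_of_subset_of_card_le hPP (by omega)).symm,
    Finset.eq_of_subset_of_card_le hQQ (by omega)⟩

theorem cutValue_facetPoint_self (hn : n + 1 = 2 * k) (hm : m = 2 * k + 1)
    {P : Finset (Fin n)} {Q : Finset (Fin m)} (hP : P.card = k) (hQ : Q.card = k + 1) :
    cutValue P Q (facetPoint k P Q) = 0 := by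
  have hn' : (n : ℤ) = 2 * k - 1 := by omega
  have hm' : (m : ℤ) = 2 * k + 1 := by omega
  rw [cutValue_facetPoint, hP, hQ, hn', hm', Finset.inter_self, hP, sdiff_self,
    Int.cast_eq_zero]
  simp only [Finset.bot_eq_empty, Finset.card_empty]
  push_cast
  ring

theorem cutValue_center_pos (hk : 1 ≤ k) (hn : n + 1 = 2 * k) (hm : m = 2 * k + 1)
    {P : Finset (Fin n)} {Q : Finset (Fin m)} (hP : P.card = k) (hQ : Q.card = k + 1) :
    0 < cutValue P Q (center n m) := by
  have hn0 : 0 < n := by omega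
  have hm0 : 0 < m := by omega
  have hnm : (0 : ℝ) < n * m := by positivity
  have hn' : (n : ℤ) = 2 * k - 1 := by omega
  have hm' : (m : ℤ) = 2 * k + 1 := by omega
  have h := cutValue_center hn0 hm0 P Q
  have h1 : (m * P.card - n * Q.card : ℤ) = 1 := by
    rw [hP, hQ, hn', hm']
    push_cast
    ring
  rw [h1, Int.cast_one] at h
  exact pos_of_mul_pos_right (h ▸ one_pos) hnm.le

theorem cutSection_isFacet_of_mem_chamberComplex (hk : 1 ≤ k) (hn : n + 1 = 2 * k)
    (hm : m = 2 * k + 1) (hcop : n.Coprime m) {C : PointedCone ℝ (Fin n ⊕ Fin m → ℝ)}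
    (hC : C ∈ chamberComplex (incidence n m)) (hcC : center n m ∈ C)
    {P : Finset (Fin n)} {Q : Finset (Fin m)} (hP : P.card = k) (hQ : Q.card = k + 1) :
    IsFacet (cutSection C P Q) C := by
  have hn0 : 0 < n := by omega
  have hm0 : 0 < m := by omega
  have hpos := cutValue_center_pos hk hn hm hP hQ
  have hbal := center_mem_balanced hn0 hm0
  have hy : facetPoint k P Q ∈ cutRegion (center n m) :=
    facetPoint_mem_cutRegion hn0 hm0 hP (by omega)
  refine cutSection_isFacet
    (fun x hx => pos_incidence_le_balanced (le_pos_of_mem_chamberComplex hC hx))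
    (fun x hx => cutValue_nonneg_of_mem_chamberComplex hC hcC hx hpos) hbal
    (cutRegion_subset_of_mem_chamberComplex hn0 (isGeneric_center hn0 hm0 hcop) hC hcC)
    hpos.ne' hy (cutValue_facetPoint_self hn hm hP hQ) ?_
  intro w hw hwPQ P' Q' hne hzero
  -- A cut negative at the center is replaced by its complement, which has the same hyperplane on
  -- balanced points.
  rcases hne.lt_or_gt with h | h
  · have h1 : 0 < cutValue P'ᶜ Q'ᶜ (center n m) := by
      rw [cutValue_compl hbal]
      exact neg_pos.2 h
    have h2 : cutValue P'ᶜ Q'ᶜ (facetPoint k P Q) = 0 := by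
      rw [cutValue_compl hy.1, hzero, neg_zero]
    obtain ⟨rfl, rfl⟩ := eq_of_cutValue_facetPoint_eq_zero hk hn hm hP hQ h1 h2
    rw [cutValue_compl hw] at hwPQ
    exact neg_eq_zero.1 hwPQ
  · obtain ⟨rfl, rfl⟩ := eq_of_cutValue_facetPoint_eq_zero hk hn hm hP hQ h hzero
    exact hwPQ

theorem ncard_cutSection (hk : 1 ≤ k) (hn : n + 1 = 2 * k)
    (hm : m = 2 * k + 1) (hcop : n.Coprime m) {C : PointedCone ℝ (Fin n ⊕ Fin m → ℝ)}
    (hC : C ∈ chamberComplex (incidence n m)) (hcC : center n m ∈ C) :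
    {F | ∃ (P : Finset (Fin n)) (Q : Finset (Fin m)),
      P.card = k ∧ Q.card = k + 1 ∧ F = cutSection C P Q}.ncard = n.choose k * m.choose (k + 1) := by
  have hn0 : 0 < n := by omega
  have hm0 : 0 < m := by omega
  have hbal : ∀ x ∈ C, x ∈ balanced n m :=
    fun x hx => pos_incidence_le_balanced (le_pos_of_mem_chamberComplex hC hx)
  let A : Finset (Finset (Fin n) × Finset (Fin m)) :=
    Finset.powersetCard k Finset.univ ×ˢ Finset.powersetCard (k + 1) Finset.univ
  have hA : {F | ∃ (P : Finset (Fin n)) (Q : Finset (Fin m)),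
      P.card = k ∧ Q.card = k + 1 ∧ F = cutSection C P Q} =
      (fun PQ => cutSection C PQ.1 PQ.2) '' (A : Set (Finset (Fin n) × Finset (Fin m))) := by
    ext F
    constructor
    · rintro ⟨P, Q, hP, hQ, rfl⟩
      exact ⟨(P, Q), by simp [A, hP, hQ], rfl⟩
    · rintro ⟨⟨P, Q⟩, hPQ, rfl⟩
      have : P.card = k ∧ Q.card = k + 1 := by simpa [A] using hPQ
      exact ⟨P, Q, this.1, this.2, rfl⟩
  rw [hA, Set.InjOn.ncard_image, Set.ncard_coe_finset]
  · simp [A]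
  · rintro ⟨P, Q⟩ hPQ ⟨P', Q'⟩ hPQ' heq
    have h : P.card = k ∧ Q.card = k + 1 := by simpa [A] using hPQ
    have h' : P'.card = k ∧ Q'.card = k + 1 := by simpa [A] using hPQ'
    have heq' : cutSection C P Q = cutSection C P' Q' := heq
    have hmem : facetPoint k P Q ∈ cutSection C P Q := (mem_cutSection hbal).2
      ⟨cutRegion_subset_of_mem_chamberComplex hn0 (isGeneric_center hn0 hm0 hcop) hC hcC
        (facetPoint_mem_cutRegion hn0 hm0 h.1 (by omega)),
        cutValue_facetPoint_self hn hm h.1 h.2⟩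
    rw [heq', mem_cutSection hbal] at hmem
    obtain ⟨rfl, rfl⟩ := eq_of_cutValue_facetPoint_eq_zero hk hn hm h.1 h.2
      (cutValue_center_pos hk hn hm h'.1 h'.2) hmem.2
    rfl

/-- The central binomial bound gives 4^k ≤ 4k · C(2k-1, k), and C(2k+1, k+1) ≥ C(2k+1, 2) = k(2k+1)
> 4k once k ≥ 2. -/
theorem four_pow_lt_choose_mul_choose (hk : 2 ≤ k) :
    4 ^ k < (2 * k - 1).choose k * (2 * k + 1).choose (k + 1) := by
  have h1 : 4 ^ k ≤ 4 * k * (2 * k - 1).choose k := by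
    have h := Nat.four_pow_le_two_mul_self_mul_centralBinom k (by omega)
    obtain ⟨j, rfl⟩ : ∃ j, k = j + 1 := ⟨k - 1, by omega⟩
    have h2 : (j + 1).centralBinom = 2 * (2 * (j + 1) - 1).choose (j + 1) := by
      have h3 : 2 * (j + 1) - 1 = 2 * j + 1 := by omega
      rw [Nat.centralBinom_eq_two_mul_choose, h3, show 2 * (j + 1) = 2 * j + 1 + 1 by ring,
        Nat.choose_succ_succ, Nat.choose_symm_half]
      ring
    rw [h2] at h
    linarith
  have h2 : 4 * k < (2 * k + 1).choose (k + 1) := by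
    have h := Nat.choose_le_middle 2 (2 * k + 1)
    have h3 : (2 * k + 1) / 2 = k := by omega
    have h4 : (2 * k + 1).choose 2 = k * (2 * k + 1) := by
      rw [Nat.choose_two_right, Nat.add_sub_cancel, mul_comm (2 * k + 1), mul_assoc,
        Nat.mul_div_cancel_left _ two_pos]
    rw [h3, h4] at h
    rw [Nat.choose_symm_half]
    nlinarith
  have h3 : 0 < (2 * k - 1).choose k := Nat.choose_pos (by omega)
  calc 4 ^ k ≤ 4 * k * (2 * k - 1).choose k := h1
    _ < (2 * k + 1).choose (k + 1) * (2 * k - 1).choose k := Nat.mul_lt_mul_of_pos_right h2 h3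
    _ = _ := mul_comm _ _

end Center

end ChamberComplex

end

theorem proposition2p6 (k : ℕ) (hk : 1 ≤ k) :
    -- the chamber complex `Γ(B)` is well defined
    (∃! Γ, ChamberComplex.IsChamberComplex (ChamberComplex.incidence (2 * k - 1) (2 * k + 1)) Γ) ∧
    ∀ Γ, ChamberComplex.IsChamberComplex (ChamberComplex.incidence (2 * k - 1) (2 * k + 1)) Γ →
      -- so is its central chamber
      (∃! C, ChamberComplex.IsCentralChamber (2 * k - 1) (2 * k + 1) Γ C) ∧
      ∀ C, ChamberComplex.IsCentralChamber (2 * k - 1) (2 * k + 1) Γ C →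
        -- every cut hyperplane of type `(k, k + 1)` is a facet of the central chamber
        (∀ (P : Finset (Fin (2 * k - 1))) (Q : Finset (Fin (2 * k + 1))),
          P.card = k → Q.card = k + 1 →
            ChamberComplex.IsFacet (ChamberComplex.cutSection C P Q) C) ∧
        -- the number of these facets
        {F | ∃ (P : Finset (Fin (2 * k - 1))) (Q : Finset (Fin (2 * k + 1))),
          P.card = k ∧ Q.card = k + 1 ∧ F = ChamberComplex.cutSection C P Q}.ncard =
            (2 * k - 1).choose k * (2 * k + 1).choose (k + 1) ∧
        -- the lower bound
        (2 ≤ k → 4 ^ k < (2 * k - 1).choose k * (2 * k + 1).choose (k + 1) ∧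
          4 ^ k ≤ {F | ChamberComplex.IsFacet F C}.ncard) := by
  open ChamberComplex in
  have hΓ := chamberComplex_isChamberComplex
    (exists_isTriangulation_incidence (n := 2 * k - 1) (m := 2 * k + 1))
  refine ⟨⟨_, hΓ, fun Γ h => h.eq hΓ⟩, fun Γ h => ?_⟩
  obtain rfl := h.eq hΓ
  have hn0 : 0 < 2 * k - 1 := by omega
  have hm0 : 0 < 2 * k + 1 := by omega
  have hn : 2 * k - 1 + 1 = 2 * k := by omega
  have hcop : (2 * k - 1).Coprime (2 * k + 1) := by
    have h1 : 2 * k + 1 = 2 * k - 1 + 2 := by omega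
    rw [h1, Nat.coprime_self_add_right, Nat.coprime_comm, Nat.coprime_two_left]
    exact ⟨k - 1, by omega⟩
  have hgen := isGeneric_center hn0 hm0 hcop
  have hbal := center_mem_balanced hn0 hm0
  have hpos := center_mem_pos hn0 hm0
  refine ⟨?_, fun C hC => ?_⟩
  · obtain ⟨C, hC, hcC, hsub⟩ := exists_chamber_of_isGeneric hn0 hgen hpos
    have hCpos := le_pos_of_mem_chamberComplex hC
    refine ⟨C, ⟨⟨hC, ?_⟩, hcC⟩, fun D hD => ?_⟩
    · rw [coneDim, coneDim,
        span_eq_balanced hbal (fun x hx => pos_incidence_le_balanced (hCpos hx)) hsub,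
        span_eq_balanced hbal (fun x hx => pos_incidence_le_balanced hx) (hsub.trans hCpos)]
    · exact le_antisymm (chamber_unique hn0 hgen hbal hD.1.1 hC hD.2 hcC)
        (chamber_unique hn0 hgen hbal hC hD.1.1 hcC hD.2)
  · have hfacet : ∀ (P : Finset (Fin (2 * k - 1))) (Q : Finset (Fin (2 * k + 1))),
        P.card = k → Q.card = k + 1 → IsFacet (cutSection C P Q) C := fun P Q hP hQ =>
      cutSection_isFacet_of_mem_chamberComplex hk hn rfl hcop hC.1.1 hC.2 hP hQ
    have hcard := ncard_cutSection hk hn rfl hcop hC.1.1 hC.2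
    refine ⟨hfacet, hcard, fun hk2 => ⟨four_pow_lt_choose_mul_choose hk2, ?_⟩⟩
    refine (four_pow_lt_choose_mul_choose hk2).le.trans (hcard ▸ Set.ncard_le_ncard ?_ ?_)
    · rintro _ ⟨P, Q, hP, hQ, rfl⟩
      exact hfacet P Q hP hQ
    -- Finiteness matters because `ncard` is 0 on infinite sets; facets are faces, hence members of
    -- the finite complex.
    · exact hΓ.1.complex.finite.subset fun F hF => hΓ.1.complex.face_mem C hC.1.1 F hF.1
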